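/- Write $\mathbb N=\{1,2,\dots\}$ and $\mathbb N_0=\mathbb N\cup\{0\}$. Fix integers $d\ge 1$ and $k\ge 2$. For $x\in\mathbb R^d$ let $\{x\}\in[0,1)^d$ be the coordinatewise fractional part, and for $l\in\mathbb N$ let $T_l\colon[0,1)^d\to[0,1)^d$, $T_l(x)=\{lx\}$. A set $S\subset\mathbb R^d$ is semialgebraic if it is a finite union of sets of the form $\{x : f(x)=0 \text{ for all } f\in F,\ g(x)>0 \text{ for all } g\in G\}$ with $F,G$ finite sets of real polynomials in $d$ variables. A set $E\subset\mathbb N$ is $\mathrm{IP}^*$ if for every sequence $(n_i)_{i\ge1}$ in $\mathbb N$ it contains a sum $\sum_{i\in I}n_i$ with $I\subset\mathbb N$ finite and non-empty; it is $\mathrm{IP}^*_+$ if $E=F+c$ for some $\mathrm{IP}^*$ set $F\subset\mathbb N$ and some $c\in\mathbb Z$. A set $E\subset\mathbb N$ is central if there are a compact metric space $(X,\rho)$, a continuous map $T\colon X\to X$, points $x,y\in X$ and an open neighbourhood $U$ of $y$ such that $\liminf_{n\to\infty}\rho(T^nx,T^ny)=0$, such that $y$ is uniformly recurrent (for every open $W\ni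 y$ the set $\{n\in\mathbb N: T^ny\in W\}$ has bounded gaps), and such that $E=\{n\in\mathbb N: T^nx\in U\}$. Let $\beta\mathbb N_0$ be the set of ultrafilters on $\mathbb N_0$, with the addition for which $A\in p+q$ if and only if $\{n:\{m: n+m\in A\}\in q\}\in p$; a property holds for $p$-almost all $n$ if the set of $n\in\mathbb N_0$ having it belongs to $p$. A minimal idempotent is a $q\in\beta\mathbb N_0$ such that $q+q=q$ and for every $r\in\beta\mathbb N_0$ there is $s\in\beta\mathbb N_0$ with $s+r+q=q$. **Theorem.** Let $S\subset[0,1)^d$ be a semialgebraic set. (1) Let $x\in\mathbb R^d$, and suppose that $\{n\in\mathbb N:\{k^nx\}\in S\}$ is central. Then the set of $l\in\mathbb N$ such that $\{lk^nx\}\in S$ for infinitely many $n\in\mathbb N$ is $\mathrm{IP}^*_+$. (2) Let $x^0\in[0,1)^d$ and $x^n=T_k^n(x^0)$ for $n\in\mathbb N_0$. Let $q\in\beta\mathbb N_0$ be a minimal idempotent and $p\in\beta\mathbb N_0+q$, and suppose that $x^n\in S$ for $p$-almost all $n$. Then the set of $l\in\mathbb N$ such that $T_l(x^n)\in S$ for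 $q$-almost all $n$ is $\mathrm{IP}^*_+$. -/

import Mathlib

/-! ### Finite sums, `IP*` sets and their translates

Lean's `ℕ` contains `0`; sets of positive integers are sets `E : Set ℕ` with `0 < n` made
explicit. -/

/-- `E` is `IP*`: it meets the set of finite sums `∑_{i ∈ I} a_i` (`I` finite and nonempty) of every
sequence of positive integers. -/
def IsIPStar (E : Set ℕ) : Prop :=
  ∀ a : Stream' ℕ, (∀ i, 0 < a.get i) → (E ∩ Hindman.FS a).Nonempty

/-- `E` is `IP*₊`: it is the translate, by some integer, of an `IP*` set of positive integers
(the equality is one of subsets of `ℤ`). -/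
def IsIPStarPlus (E : Set ℕ) : Prop :=
  ∃ (c : ℤ) (F : Set ℕ), (∀ n ∈ F, 0 < n) ∧ IsIPStar F ∧
    (fun n : ℕ => (n : ℤ)) '' E = (fun n : ℕ => (n : ℤ) + c) '' F

/-! ### Topological dynamics and central sets -/

/-- A set of natural numbers with bounded gaps. -/
def HasBoundedGaps (A : Set ℕ) : Prop :=
  ∃ L : ℕ, ∀ n : ℕ, ∃ m ∈ A, n ≤ m ∧ m ≤ n + L

/-- `y` returns to each of its open neighbourhoods along a set with bounded gaps. -/
def IsUniformlyRecurrent {X : Type*} [TopologicalSpace X] (T : X → X) (y : X) : Prop :=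
  ∀ U : Set X, IsOpen U → y ∈ U → HasBoundedGaps {n : ℕ | 0 < n ∧ T^[n] y ∈ U}

/-- `x` and `y` are proximal: `liminf_{n → ∞} dist (T^n x) (T^n y) = 0`. -/
def AreProximal {X : Type*} [MetricSpace X] (T : X → X) (x y : X) : Prop :=
  ∀ ε : ℝ, 0 < ε → ∃ᶠ n : ℕ in Filter.atTop, dist (T^[n] x) (T^[n] y) < ε

/-- Central sets: `E = {n ≥ 1 : T^n x ∈ U}` for a continuous self-map `T` of a compact metric space,
a point `x` proximal to a uniformly recurrent point `y`, and an open neighbourhood `U` of `y`.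
(A compact metric space has at most the cardinality of the continuum, so that spaces in `Type`
are all that is needed.) -/
def IsCentral (E : Set ℕ) : Prop :=
  ∃ (X : Type) (_ : MetricSpace X) (_ : CompactSpace X) (T : X → X) (x y : X) (U : Set X),
    Continuous T ∧ AreProximal T x y ∧ IsUniformlyRecurrent T y ∧ IsOpen U ∧ y ∈ U ∧
      E = {n : ℕ | 0 < n ∧ T^[n] x ∈ U}

/-! ### Ultrafilters

`Ultrafilter ℕ` is `βℕ₀`. Its addition is Mathlib's: a set `A` belongs to `p + q` if and only if,
for `p`-almost all `n` and `q`-almost all `m`, `n + m ∈ A`. -/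

attribute [local instance] Ultrafilter.add

/-- `q` is a minimal idempotent of `βℕ₀`: `q + q = q`, and the left ideal `βℕ₀ + q` is minimal. -/
def IsMinimalIdempotent (q : Ultrafilter ℕ) : Prop :=
  q + q = q ∧ ∀ r : Ultrafilter ℕ, ∃ s : Ultrafilter ℕ, s + (r + q) = q

/-! ### Semialgebraic sets -/

/-- The set of solutions of finitely many polynomial equations `f = 0` and strict polynomial
inequalities `g > 0`. -/
def IsBasicSemialgebraic {d : ℕ} (S : Set (Fin d → ℝ)) : Prop :=
  ∃ F G : Finset (MvPolynomial (Fin d) ℝ),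
    S = {x | (∀ f ∈ F, MvPolynomial.eval x f = 0) ∧ (∀ g ∈ G, 0 < MvPolynomial.eval x g)}

/-- A finite union of basic semialgebraic sets. -/
def IsSemialgebraic {d : ℕ} (S : Set (Fin d → ℝ)) : Prop :=
  ∃ C : Set (Set (Fin d → ℝ)), C.Finite ∧ (∀ B ∈ C, IsBasicSemialgebraic B) ∧ S = ⋃₀ C

/-! ### Multiplication maps on the cube -/

/-- The half-open cube `[0,1)^d`. -/
def halfOpenCube (d : ℕ) : Set (Fin d → ℝ) :=
  {x | ∀ i, x i ∈ Set.Ico (0 : ℝ) 1}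

/-- The coordinatewise fractional part. -/
noncomputable def fracPart {d : ℕ} (x : Fin d → ℝ) : Fin d → ℝ :=
  fun i => Int.fract (x i)

/-- The map `T_l : x ↦ {l x}`. -/
noncomputable def timesMap {d : ℕ} (l : ℕ) (x : Fin d → ℝ) : Fin d → ℝ :=
  fracPart ((l : ℝ) • x)

open Filter Topology

/-! ### Idempotent ultrafilters and vanishing polynomials -/

/-! Let `y` be the limit of `k ^ n • x` modulo the integer lattice along an idempotent `q`, and
write `k ^ n • x ≡ y + ε n`, `k ^ n • y ≡ y + δ n` with `ε` and `δ` tending to `0` along `q`.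
Idempotency yields `ε (n + m) = δ n + k ^ n • ε m`, and the same rule with `δ` in place of `ε`, for
almost all `n` and then almost all `m` (`eventually_cocycle`).

The polynomials vanishing along `δ` are therefore stable under the homotheties `v ↦ δ n + k ^ n •
v`. Homotheties with distinct centres generate translations, which forces the Zariski closure of `δ`
to be a linear subspace `L`, spanned by differences of the centres
(`exists_zariski_dense_subspace`). Adding `y` to a centre gives a rational point. So `L` has a
rational spanning set and `y` is a rational point up to `L`; hence every set of finite sums contains
large `l` for which `l • y` is close to the lattice with error in `L` (`exists_mem_FS_smul_near`).

As a polynomial in `t`, and up to positive factors depending on `m`, `f (z + κ • (w + t • ε m))`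
either vanishes on `L` for almost all `m` or has a limit whose leading coefficient is a nonzero
polynomial on `L`. By density that coefficient is nonzero at almost every `δ n`, so the sign is
constant for `w ∈ L` near `δ n`, `t` large and almost all `m` (`eventually_exists_sign`). The
hypothesis on `S` at times `N + n + n' + m`, with `κ = k ^ N`, tells which sign it is.

Finally, take `l = l₁ - l₂ + k ^ (N + n₁)`, with `l₁` a finite sum and `l₁ • y`, `l₂ • y` near the
lattice along `L`. Then `l • y ≡ κ • (y + w)` with `w ∈ L` near `δ n₁`, so `l • k ^ m • x` is
congruent to a point of `S`. The shift `l₂ - k ^ (N + n₁)` does not depend on the sequence of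
summands. -/

theorem eventually_add_of_idempotent {q : Ultrafilter ℕ} (hq : q + q = q) {P : ℕ → Prop}
    (h : ∀ᶠ n in (q : Filter ℕ), P n) :
    ∀ᶠ n in (q : Filter ℕ), ∀ᶠ m in (q : Filter ℕ), P (n + m) := by
  rw [← hq] at h
  exact (Ultrafilter.eventually_add q q P).1 h

/-- The affine map `v ↦ b + s v` sends polynomials vanishing along `δ` to polynomials vanishing
along `δ`. -/
def PreservesVanishing {d : ℕ} (q : Ultrafilter ℕ) (δ : ℕ → Fin d → ℝ) (b : Fin d → ℝ) (s : ℝ) :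
    Prop :=
  ∀ h : MvPolynomial (Fin d) ℝ, (∀ᶠ m in (q : Filter ℕ), MvPolynomial.eval (δ m) h = 0) →
    ∀ᶠ m in (q : Filter ℕ), MvPolynomial.eval (b + s • δ m) h = 0

/-- The substitution `X ↦ b + s X`. -/
noncomputable def affineSubst {d : ℕ} (b : Fin d → ℝ) (s : ℝ) (h : MvPolynomial (Fin d) ℝ) :
    MvPolynomial (Fin d) ℝ :=
  MvPolynomial.bind₁ (fun i => MvPolynomial.C (b i) + MvPolynomial.C s * MvPolynomial.X i) h

theorem eval_affineSubst {d : ℕ} (b : Fin d → ℝ) (s : ℝ) (h : MvPolynomial (Fin d) ℝ)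
    (v : Fin d → ℝ) :
    MvPolynomial.eval v (affineSubst b s h) = MvPolynomial.eval (b + s • v) h := by
  rw [affineSubst, MvPolynomial.eval, MvPolynomial.eval₂Hom_bind₁]
  congr 2
  ext i
  simp

theorem PreservesVanishing.comp {d : ℕ} {q : Ultrafilter ℕ} {δ : ℕ → Fin d → ℝ}
    {b b' : Fin d → ℝ} {s s' : ℝ} (h : PreservesVanishing q δ b s)
    (h' : PreservesVanishing q δ b' s') : PreservesVanishing q δ (b + s • b') (s * s') := by
  intro f hf
  have h1 := h' (affineSubst b s f) (by simpa only [eval_affineSubst] using h f hf)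
  filter_upwards [h1] with m hm
  rw [eval_affineSubst] at hm
  rw [← hm]
  congr 2
  rw [smul_add, smul_smul, add_assoc]

/-- The point fixed by the affine map `v ↦ δ n + k ^ n v`. -/
noncomputable def fixedPt {d : ℕ} (k : ℕ) (δ : ℕ → Fin d → ℝ) (n : ℕ) : Fin d → ℝ :=
  -(((k : ℝ) ^ n - 1)⁻¹ • δ n)

theorem one_lt_natCast_pow {k n : ℕ} (hk : 2 ≤ k) (hn : 0 < n) : (1 : ℝ) < (k : ℝ) ^ n :=
  one_lt_pow₀ (by exact_mod_cast hk) hn.ne'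

theorem smul_fixedPt {d k n : ℕ} (hk : 2 ≤ k) (hn : 0 < n) (δ : ℕ → Fin d → ℝ) :
    ((k : ℝ) ^ n - 1) • fixedPt k δ n = -δ n := by
  have := one_lt_natCast_pow hk hn
  rw [fixedPt, smul_neg, smul_smul, mul_inv_cancel₀ (by linarith), one_smul]

/-- The map `v ↦ δ n + k ^ n • v` is the homothety of ratio `k ^ n` about `fixedPt k δ n`; this is
its `i`-th iterate. -/
theorem PreservesVanishing.pow {d k : ℕ} (hk : 2 ≤ k) {q : Ultrafilter ℕ} {δ : ℕ → Fin d → ℝ}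
    {n : ℕ} (hn : 0 < n) (h : PreservesVanishing q δ (δ n) ((k : ℝ) ^ n)) (i : ℕ) :
    PreservesVanishing q δ ((1 - ((k : ℝ) ^ n) ^ i) • fixedPt k δ n) (((k : ℝ) ^ n) ^ i) := by
  induction i with
  | zero => intro f hf; simpa using hf
  | succ i ih =>
    have h1 := ih.comp h
    rw [← pow_succ] at h1
    convert h1 using 1
    have h2 := smul_fixedPt hk hn δ
    rw [← neg_eq_iff_eq_neg] at h2
    rw [← h2]
    module

/-- The restriction of a polynomial to the line `s ↦ b + s c`. -/
theorem exists_polynomial_line {d : ℕ} (h : MvPolynomial (Fin d) ℝ) :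
    ∃ D : ℕ, ∀ b c : Fin d → ℝ, ∃ P : Polynomial ℝ, P.natDegree ≤ D ∧
      ∀ s : ℝ, P.eval s = MvPolynomial.eval (b + s • c) h := by
  let H : Polynomial (MvPolynomial (Fin d ⊕ Fin d) ℝ) :=
    MvPolynomial.aeval (fun i => Polynomial.C (MvPolynomial.X (Sum.inl i)) +
      Polynomial.X * Polynomial.C (MvPolynomial.X (Sum.inr i))) h
  refine ⟨H.natDegree, fun b c => ⟨H.map (MvPolynomial.eval (Sum.elim b c)),
    Polynomial.natDegree_map_le, fun s => ?_⟩⟩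
  have key : ((Polynomial.evalRingHom s).comp
      (Polynomial.mapRingHom (MvPolynomial.eval (Sum.elim b c)))).comp
      (MvPolynomial.aeval (fun i : Fin d => Polynomial.C (MvPolynomial.X (Sum.inl i)) +
      Polynomial.X * Polynomial.C (MvPolynomial.X (Sum.inr i)) :
        Fin d → Polynomial (MvPolynomial (Fin d ⊕ Fin d) ℝ))).toRingHom =
      MvPolynomial.eval (b + s • c) := by
    refine MvPolynomial.ringHom_ext (fun r => ?_) (fun i => ?_)
    · simp [Polynomial.algebraMap_apply]
    · simp
      ring
  exact congrArg (fun g => g h) key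

/-- On the line through the centre and `δ m`, `f` is a polynomial in the ratio `s`. It vanishes at
all powers of `k ^ n` up to its degree bound, hence identically. -/
theorem PreservesVanishing.all_scalings {d k : ℕ} (hk : 2 ≤ k) {q : Ultrafilter ℕ}
    {δ : ℕ → Fin d → ℝ} {n : ℕ} (hn : 0 < n)
    (h : PreservesVanishing q δ (δ n) ((k : ℝ) ^ n)) (s : ℝ) :
    PreservesVanishing q δ ((1 - s) • fixedPt k δ n) s := by
  intro f hf
  obtain ⟨D, hD⟩ := exists_polynomial_line f
  -- The bound `D` does not depend on the line, so finitely many conditions suffice for almost all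
  -- `m` at once.
  have h1 : ∀ᶠ m in (q : Filter ℕ), ∀ i ∈ Finset.range (D + 1), MvPolynomial.eval
      ((1 - ((k : ℝ) ^ n) ^ i) • fixedPt k δ n + (((k : ℝ) ^ n) ^ i) • δ m) f = 0 :=
    (Filter.eventually_all_finset _).2 fun i _ => h.pow hk hn i f hf
  filter_upwards [h1] with m hm
  obtain ⟨P, hP, hPe⟩ := hD (fixedPt k δ n) (δ m - fixedPt k δ n)
  have hline : ∀ s : ℝ, fixedPt k δ n + s • (δ m - fixedPt k δ n) =
      (1 - s) • fixedPt k δ n + s • δ m := fun s => by module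
  have hinj : Function.Injective fun i : ℕ => ((k : ℝ) ^ n) ^ i :=
    pow_right_injective₀ (by linarith [one_lt_natCast_pow hk hn]) (one_lt_natCast_pow hk hn).ne'
  have hP0 : P = 0 := by
    refine Polynomial.eq_zero_of_natDegree_lt_card_of_eval_eq_zero' P
      ((Finset.range (D + 1)).image fun i : ℕ => ((k : ℝ) ^ n) ^ i) ?_ ?_
    · intro r hr
      obtain ⟨i, hi, rfl⟩ := Finset.mem_image.1 hr
      rw [hPe, hline]
      exact hm i hi
    · rw [Finset.card_image_of_injective _ hinj, Finset.card_range]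
      omega
  rw [← hline, ← hPe, hP0, Polynomial.eval_zero]

/-- Homotheties of ratios `s` and `s⁻¹` about `v` and `v'` compose to the translation by `(1 - s) •
(v - v')`. Since `c = 1` would need `s = 0`, it is reached as `2 + (-1)`. -/
theorem PreservesVanishing.translation {d k : ℕ} (hk : 2 ≤ k) {q : Ultrafilter ℕ}
    {δ : ℕ → Fin d → ℝ} {n n' : ℕ} (hn : 0 < n) (hn' : 0 < n')
    (h : PreservesVanishing q δ (δ n) ((k : ℝ) ^ n))
    (h' : PreservesVanishing q δ (δ n') ((k : ℝ) ^ n')) (c : ℝ) :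
    PreservesVanishing q δ (c • (fixedPt k δ n - fixedPt k δ n')) 1 := by
  rcases eq_or_ne c 1 with rfl | hc
  · have h1 := (h.all_scalings hk hn (1 - 2)).comp (h'.all_scalings hk hn' (1 - 2)⁻¹)
    have h2 := (h.all_scalings hk hn 2).comp (h'.all_scalings hk hn' 2⁻¹)
    have h3 := h1.comp h2
    convert h3 using 1
    · module
    · norm_num
  · have h1 := (h.all_scalings hk hn (1 - c)).comp (h'.all_scalings hk hn' (1 - c)⁻¹)
    have h2 : (1 - c) ≠ 0 := sub_ne_zero.2 hc.symm
    rw [mul_inv_cancel₀ h2] at h1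
    convert h1 using 1
    rw [smul_smul, mul_sub, mul_inv_cancel₀ h2]
    module

/-- Along an idempotent ultrafilter, a null sequence `δ` with `δ (n + m) = δ n + k ^ n δ m` is
Zariski dense in a linear subspace spanned by differences of fixed points. -/
theorem exists_zariski_dense_subspace {d k : ℕ} (hk : 2 ≤ k) {q : Ultrafilter ℕ} (hq : q + q = q)
    (hq' : (q : Filter ℕ) ≤ atTop) {δ : ℕ → Fin d → ℝ} (hδ : Tendsto δ q (𝓝 0))
    (hcoc : ∀ᶠ n in (q : Filter ℕ), ∀ᶠ m in (q : Filter ℕ), δ (n + m) = δ n + (k : ℝ) ^ n • δ m) :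
    ∃ A ∈ q, (∀ n ∈ A, 0 < n) ∧ ∃ L : Submodule ℝ (Fin d → ℝ),
      L = Submodule.span ℝ {w | ∃ n ∈ A, ∃ n' ∈ A, w = fixedPt k δ n - fixedPt k δ n'} ∧
      (∀ n ∈ A, δ n ∈ L ∧ fixedPt k δ n ∈ L) ∧
      ∀ h : MvPolynomial (Fin d) ℝ, (∀ᶠ m in (q : Filter ℕ), MvPolynomial.eval (δ m) h = 0) →
        ∀ w ∈ L, MvPolynomial.eval w h = 0 := by
  let I : Ideal (MvPolynomial (Fin d) ℝ) :=
    { carrier := {h | ∀ᶠ m in (q : Filter ℕ), MvPolynomial.eval (δ m) h = 0}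
      add_mem' := fun {a b} ha hb => by
        filter_upwards [ha, hb] with m h1 h2
        rw [map_add, h1, h2, add_zero]
      zero_mem' := Eventually.of_forall fun m => map_zero _
      smul_mem' := fun c a ha => by
        filter_upwards [ha] with m h1
        rw [smul_eq_mul, map_mul, h1, mul_zero] }
  have memI : ∀ h, h ∈ I ↔ ∀ᶠ m in (q : Filter ℕ), MvPolynomial.eval (δ m) h = 0 := fun _ => Iff.rfl
  have hA : ∀ᶠ n in (q : Filter ℕ), PreservesVanishing q δ (δ n) ((k : ℝ) ^ n) := by
    -- Finitely many generators of `I` allow one `q`-large set of `n` to serve every polynomial in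
    -- `I`.
    obtain ⟨s, hs⟩ := (isNoetherianRing_iff_ideal_fg _).1 inferInstance I
    have h1 : ∀ᶠ n in (q : Filter ℕ), ∀ h ∈ s, affineSubst (δ n) ((k : ℝ) ^ n) h ∈ I := by
      refine (Filter.eventually_all_finset _).2 fun h hh => ?_
      have h2 : h ∈ I := hs ▸ Ideal.subset_span hh
      filter_upwards [eventually_add_of_idempotent hq h2, hcoc] with n h3 h4
      filter_upwards [h3, h4] with m h5 h6
      rw [eval_affineSubst, ← h6, h5]
    filter_upwards [h1] with n hn f hf
    have h2 : I ≤ I.comap (MvPolynomial.bind₁ (fun i => MvPolynomial.C (δ n i) +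
        MvPolynomial.C ((k : ℝ) ^ n) * MvPolynomial.X i)).toRingHom := by
      conv_lhs => rw [← hs]
      exact Ideal.span_le.2 hn
    have h3 : affineSubst (δ n) ((k : ℝ) ^ n) f ∈ I := h2 hf
    simpa only [memI, eval_affineSubst] using h3
  have hpos : ∀ᶠ n in (q : Filter ℕ), 0 < n := hq' (eventually_gt_atTop 0)
  refine ⟨{n | 0 < n ∧ PreservesVanishing q δ (δ n) ((k : ℝ) ^ n)}, hpos.and hA, fun n hn => hn.1,
    _, rfl, ?_, ?_⟩
  · set A : Set ℕ := {n | 0 < n ∧ PreservesVanishing q δ (δ n) ((k : ℝ) ^ n)}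
    set L := Submodule.span ℝ {w | ∃ n ∈ A, ∃ n' ∈ A, w = fixedPt k δ n - fixedPt k δ n'}
    have hv : Tendsto (fixedPt k δ) q (𝓝 0) := by
      refine squeeze_zero_norm' ?_ (tendsto_zero_iff_norm_tendsto_zero.1 hδ)
      filter_upwards [hpos] with n hn
      have h1 : (2 : ℝ) ≤ (k : ℝ) ^ n := by
        calc (2 : ℝ) ≤ k := by exact_mod_cast hk
          _ ≤ (k : ℝ) ^ n := le_self_pow₀ (by exact_mod_cast (by omega : 1 ≤ k)) hn.ne'
      rw [fixedPt, norm_neg, norm_smul, norm_inv, Real.norm_eq_abs, abs_of_nonneg (by linarith)]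
      exact mul_le_of_le_one_left (norm_nonneg _) (inv_le_one_of_one_le₀ (by linarith))
    have hfix : ∀ n ∈ A, fixedPt k δ n ∈ L := by
      intro n hn
      have h1 : Tendsto (fun m => fixedPt k δ n - fixedPt k δ m) q (𝓝 (fixedPt k δ n - 0)) :=
        tendsto_const_nhds.sub hv
      rw [sub_zero] at h1
      refine (Submodule.closed_of_finiteDimensional L).mem_of_tendsto h1 ?_
      filter_upwards [hpos.and hA] with m hm
      exact Submodule.subset_span ⟨n, hn, m, hm, rfl⟩
    refine fun n hn => ⟨?_, hfix n hn⟩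
    have h1 := L.smul_mem ((k : ℝ) ^ n - 1) (hfix n hn)
    rw [smul_fixedPt hk hn.1] at h1
    exact neg_mem_iff.1 h1
  · intro h hh w hw
    have key : PreservesVanishing q δ w 1 := by
      induction hw using Submodule.closure_induction with
      | zero => intro f hf; simpa using hf
      | add a b _ _ ha hb => simpa using ha.comp hb
      | smul_mem c a ha =>
        obtain ⟨n, hn, n', hn', rfl⟩ := ha
        exact hn.2.translation hk hn.1 hn'.1 hn'.2 c
    -- Since `δ` tends to `0`, vanishing at `w + δ m` passes to the limit `w`.
    have h1 : Tendsto (fun m => MvPolynomial.eval (w + (1 : ℝ) • δ m) h) q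
        (𝓝 (MvPolynomial.eval (w + (1 : ℝ) • (0 : Fin d → ℝ)) h)) :=
      ((MvPolynomial.continuous_eval h).tendsto _).comp
        (tendsto_const_nhds.add (tendsto_const_nhds.smul hδ))
    have h2 := tendsto_nhds_unique h1
      (tendsto_const_nhds.congr' ((key h hh).mono fun m hm => hm.symm))
    simpa using h2

/-! ### Signs of polynomials along an ultrafilter -/

/-- A sequence in a finitely generated space vanishes almost surely along an ultrafilter, or has
positive multiples that converge weakly to a nonzero vector. -/
theorem exists_normalized_limit {M : Type*} [AddCommGroup M] [Module ℝ M] {W : Submodule ℝ M}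
    (hW : W.FG) (q : Ultrafilter ℕ) (F : ℕ → M) (hF : ∀ m, F m ∈ W) :
    (∀ᶠ m in (q : Filter ℕ), F m = 0) ∨
      ∃ (b : ℕ → ℝ) (P : M), (∀ᶠ m in (q : Filter ℕ), 0 < b m) ∧ P ≠ 0 ∧
        ∀ φ : M →ₗ[ℝ] ℝ, Tendsto (fun m => b m * φ (F m)) q (𝓝 (φ P)) := by
  rcases q.em fun m => F m = 0 with h | h
  · exact Or.inl h
  right
  have : Module.Finite ℝ W := Module.Finite.iff_fg.2 hW
  let e := (Module.finBasis ℝ W).equivFun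
  let c : ℕ → Fin (Module.finrank ℝ W) → ℝ := fun m => e ⟨F m, hF m⟩
  have hc : ∀ᶠ m in (q : Filter ℕ), c m ≠ 0 := by
    filter_upwards [h] with m hm h0
    have h1 : (⟨F m, hF m⟩ : W) = 0 := e.map_eq_zero_iff.1 h0
    exact hm (congrArg Subtype.val h1)
  have hs : (q.map fun m => ‖c m‖⁻¹ • c m : Filter _) ≤
      𝓟 (Metric.sphere (0 : Fin (Module.finrank ℝ W) → ℝ) 1) := by
    rw [le_principal_iff]
    change ∀ᶠ m in (q : Filter ℕ), ‖c m‖⁻¹ • c m ∈ Metric.sphere 0 1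
    filter_upwards [hc] with m hm
    rw [mem_sphere_zero_iff_norm, norm_smul, norm_inv, norm_norm,
      inv_mul_cancel₀ (norm_ne_zero_iff.2 hm)]
  obtain ⟨u, hu, hlim⟩ := (isCompact_sphere _ _).ultrafilter_le_nhds _ hs
  have hu0 : u ≠ 0 := by
    rintro rfl
    simp at hu
  refine ⟨fun m => ‖c m‖⁻¹, e.symm u, ?_, ?_, fun φ => ?_⟩
  · filter_upwards [hc] with m hm
    exact inv_pos.2 (norm_pos_iff.2 hm)
  · intro h0
    exact hu0 (e.symm.map_eq_zero_iff.1 (Subtype.ext h0))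
  · let ψ : (Fin (Module.finrank ℝ W) → ℝ) →ₗ[ℝ] ℝ := φ ∘ₗ W.subtype ∘ₗ e.symm.toLinearMap
    have h1 : Tendsto (fun m => ψ (‖c m‖⁻¹ • c m)) q (𝓝 (ψ u)) :=
      (ψ.continuous_of_finiteDimensional.tendsto u).comp hlim
    refine h1.congr fun m => ?_
    rw [map_smul, smul_eq_mul]
    simp [ψ, c]

/-- The limit is joint in the point and the variable, so the resulting sign holds on a whole
neighbourhood of `x₀` at once. -/
theorem tendsto_eval_div_pow {X : Type*} [TopologicalSpace X] {R : Type*} [CommRing R]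
    (ev : X → R →+* ℝ) (hev : ∀ r, Continuous fun x => ev x r) (P : Polynomial R) (x₀ : X) :
    Tendsto (fun xt : X × ℝ => (P.map (ev xt.1)).eval xt.2 / xt.2 ^ P.natDegree) (𝓝 x₀ ×ˢ atTop)
      (𝓝 (ev x₀ P.leadingCoeff)) := by
  have h1 : ∀ xt : X × ℝ, (P.map (ev xt.1)).eval xt.2 / xt.2 ^ P.natDegree =
      ∑ j ∈ Finset.range (P.natDegree + 1),
        ev xt.1 (P.coeff j) * (xt.2 ^ j / xt.2 ^ P.natDegree) := by
    intro xt
    rw [Polynomial.eval_map, Polynomial.eval₂_eq_sum_range, Finset.sum_div]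
    exact Finset.sum_congr rfl fun j _ => mul_div_assoc _ _ _
  simp_rw [h1]
  have h2 : ev x₀ P.leadingCoeff = ∑ j ∈ Finset.range (P.natDegree + 1),
      ev x₀ (P.coeff j) * (if j = P.natDegree then 1 else 0) := by
    simp only [mul_ite, mul_one, mul_zero, Finset.sum_ite_eq', Finset.mem_range,
      Nat.lt_succ_self, if_true, Polynomial.leadingCoeff]
  rw [h2]
  refine tendsto_finsetSum _ fun j hj => Tendsto.mul ?_ ?_
  · exact ((hev _).tendsto x₀).comp tendsto_fst
  · have h3 : Tendsto (fun t : ℝ => t ^ j / t ^ P.natDegree) atTop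
        (𝓝 (if j = P.natDegree then 1 else 0)) := by
      split_ifs with h
      · subst h
        refine tendsto_const_nhds.congr' ?_
        filter_upwards [eventually_gt_atTop 0] with t ht
        rw [div_self (pow_pos ht _).ne']
      · exact tendsto_pow_div_pow_atTop_zero
          (lt_of_le_of_ne (Nat.lt_succ_iff.1 (Finset.mem_range.1 hj)) h)
    exact h3.comp tendsto_snd

/-- A polynomial with continuous coefficients has the sign of its leading coefficient for large
values of the variable. -/
theorem eventually_sign_eval {X : Type*} [TopologicalSpace X] {R : Type*} [CommRing R]
    (ev : X → R →+* ℝ) (hev : ∀ r, Continuous fun x => ev x r) (P : Polynomial R) (x₀ : X)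
    (h0 : ev x₀ P.leadingCoeff ≠ 0) :
    ∀ᶠ xt : X × ℝ in 𝓝 x₀ ×ˢ atTop,
      SignType.sign ((P.map (ev xt.1)).eval xt.2) = SignType.sign (ev x₀ P.leadingCoeff) := by
  have h1 := tendsto_eval_div_pow ev hev P x₀
  have hpos : ∀ᶠ xt : X × ℝ in 𝓝 x₀ ×ˢ atTop, 0 < xt.2 :=
    tendsto_snd.eventually (eventually_gt_atTop 0)
  rcases lt_or_gt_of_ne h0 with h | h
  · filter_upwards [h1.eventually (gt_mem_nhds h), hpos] with xt h2 h3
    rw [sign_neg h, sign_neg]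
    by_contra! h4
    exact absurd h2 (not_lt.2 (div_nonneg h4 (pow_pos h3 _).le))
  · filter_upwards [h1.eventually (lt_mem_nhds h), hpos] with xt h2 h3
    rw [sign_pos h, sign_pos]
    by_contra! h4
    exact absurd h2 (not_lt.2 (div_nonpos_of_nonpos_of_nonneg h4 (pow_pos h3 _).le))

theorem eventually_sign_eq_of_tendsto {q : Ultrafilter ℕ} {b c : ℕ → ℝ} {l : ℝ}
    (hb : ∀ᶠ m in (q : Filter ℕ), 0 < b m) (h : Tendsto (fun m => b m * c m) q (𝓝 l))
    (hl : l ≠ 0) : ∀ᶠ m in (q : Filter ℕ), SignType.sign (c m) = SignType.sign l := by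
  rcases lt_or_gt_of_ne hl with hl | hl
  · filter_upwards [h.eventually (gt_mem_nhds hl), hb] with m h1 h2
    rw [sign_neg hl, sign_neg (neg_of_mul_neg_right h1 h2.le)]
  · filter_upwards [h.eventually (lt_mem_nhds hl), hb] with m h1 h2
    rw [sign_pos hl, sign_pos (pos_of_mul_pos_right h1 h2.le)]

/-- The algebra of polynomial functions on a subspace. -/
noncomputable abbrev polyFunctions {d : ℕ} (L : Submodule ℝ (Fin d → ℝ)) : Subalgebra ℝ (L → ℝ) :=
  (MvPolynomial.aeval fun (i : Fin d) (w : L) => (w : Fin d → ℝ) i :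
    MvPolynomial (Fin d) ℝ →ₐ[ℝ] (L → ℝ)).range

theorem polyFunctions_eq_eval {d : ℕ} {L : Submodule ℝ (Fin d → ℝ)} (r : polyFunctions L) :
    ∃ h : MvPolynomial (Fin d) ℝ, ∀ w : L, r.1 w = MvPolynomial.eval (w : Fin d → ℝ) h := by
  obtain ⟨h, hh⟩ := r.2
  refine ⟨h, fun w => ?_⟩
  have key : (Pi.evalRingHom (fun _ : L => ℝ) w).comp
      (MvPolynomial.aeval fun (i : Fin d) (w : L) => (w : Fin d → ℝ) i :
        MvPolynomial (Fin d) ℝ →ₐ[ℝ] (L → ℝ)).toRingHom =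
      MvPolynomial.eval (w : Fin d → ℝ) := by
    refine MvPolynomial.ringHom_ext (fun r => ?_) (fun i => ?_)
    · simp
    · simp
  rw [← hh]
  exact congrArg (fun g => g h) key

/-- Evaluation of a polynomial function at a point. -/
noncomputable def evalPolyFunction {d : ℕ} (L : Submodule ℝ (Fin d → ℝ)) (w : L) :
    polyFunctions L →+* ℝ :=
  (Pi.evalRingHom (fun _ : L => ℝ) w).comp (polyFunctions L).val.toRingHom

theorem continuous_evalPolyFunction {d : ℕ} {L : Submodule ℝ (Fin d → ℝ)} (r : polyFunctions L) :
    Continuous fun w => evalPolyFunction L w r := by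
  obtain ⟨h, hh⟩ := polyFunctions_eq_eval r
  exact ((MvPolynomial.continuous_eval h).comp continuous_subtype_val).congr fun w => (hh w).symm

/-- The function `(w, t) ↦ f (z + κ (w + t e))`, as a polynomial in `t` whose coefficients are
polynomial functions of `w`. -/
noncomputable def affineExpansion {d : ℕ} (L : Submodule ℝ (Fin d → ℝ)) (z : Fin d → ℝ) (κ : ℝ)
    (e : Fin d → ℝ) : MvPolynomial (Fin d) ℝ →ₐ[ℝ] Polynomial (polyFunctions L) :=
  MvPolynomial.aeval fun i => algebraMap ℝ _ (z i) +
    κ • (Polynomial.C ⟨fun w => (w : Fin d → ℝ) i, MvPolynomial.X i, by simp⟩ +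
      e i • Polynomial.X)

theorem eval_affineExpansion {d : ℕ} (L : Submodule ℝ (Fin d → ℝ)) (z : Fin d → ℝ) (κ : ℝ)
    (e : Fin d → ℝ) (f : MvPolynomial (Fin d) ℝ) (w : L) (t : ℝ) :
    ((affineExpansion L z κ e f).map (evalPolyFunction L w)).eval t =
      MvPolynomial.eval (z + κ • ((w : Fin d → ℝ) + t • e)) f := by
  have key : ((Polynomial.evalRingHom t).comp (Polynomial.mapRingHom (evalPolyFunction L w))).comp
      (affineExpansion L z κ e).toRingHom =
      MvPolynomial.eval (z + κ • ((w : Fin d → ℝ) + t • e)) := by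
    refine MvPolynomial.ringHom_ext (fun r => ?_) (fun i => ?_)
    · simp [Polynomial.algebraMap_apply, evalPolyFunction]
    · simp [affineExpansion, Polynomial.algebraMap_apply, evalPolyFunction, Algebra.smul_def]
      exact Or.inl (by ring)
  exact congrArg (fun g => g f) key

/-- One finite-dimensional space contains the expansions for all `e`; this provides the compactness
needed by `exists_normalized_limit`. -/
theorem exists_fg_affineExpansion_mem {d : ℕ} (L : Submodule ℝ (Fin d → ℝ)) (z : Fin d → ℝ)
    (κ : ℝ) (f : MvPolynomial (Fin d) ℝ) :
    ∃ W : Submodule ℝ (Polynomial (polyFunctions L)), W.FG ∧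
      ∀ e, affineExpansion L z κ e f ∈ W := by
  induction f using MvPolynomial.induction_on with
  | C a =>
    refine ⟨Submodule.span ℝ {algebraMap ℝ _ a}, Submodule.fg_span (Set.finite_singleton _),
      fun e => ?_⟩
    rw [← MvPolynomial.algebraMap_eq, AlgHom.commutes]
    exact Submodule.mem_span_singleton_self _
  | add f g hf hg =>
    obtain ⟨W, hW, hf⟩ := hf
    obtain ⟨W', hW', hg⟩ := hg
    refine ⟨W ⊔ W', hW.sup hW', fun e => ?_⟩
    rw [map_add]
    exact Submodule.add_mem_sup (hf e) (hg e)
  | mul_X f i hf =>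
    obtain ⟨W, hW, hf⟩ := hf
    refine ⟨W * Submodule.span ℝ {affineExpansion L z κ 0 (MvPolynomial.X i), Polynomial.X},
      hW.mul (Submodule.fg_span (Set.toFinite _)), fun e => ?_⟩
    rw [map_mul]
    refine Submodule.mul_mem_mul (hf e) (Submodule.mem_span_pair.2 ⟨1, κ * e i, ?_⟩)
    simp only [affineExpansion, MvPolynomial.aeval_X, Pi.zero_apply]
    module

/-- Let `δ` be Zariski dense in `L` along the ultrafilter `q`. Then, for almost all `n`, the sign of
`f (z + κ (w + t ε m))` is the same for all `w ∈ L` close to `δ n`, all large `t` and almost all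
`m`. -/
theorem eventually_exists_sign {d : ℕ} {q : Ultrafilter ℕ} {δ : ℕ → Fin d → ℝ}
    {L : Submodule ℝ (Fin d → ℝ)} (hδL : ∀ᶠ n in (q : Filter ℕ), δ n ∈ L)
    (hdense : ∀ h : MvPolynomial (Fin d) ℝ,
      (∀ᶠ m in (q : Filter ℕ), MvPolynomial.eval (δ m) h = 0) →
        ∀ w ∈ L, MvPolynomial.eval w h = 0)
    (ε : ℕ → Fin d → ℝ) (z : Fin d → ℝ) (κ : ℝ) (f : MvPolynomial (Fin d) ℝ) :
    ∀ᶠ n in (q : Filter ℕ), ∃ σ : SignType,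
      ∀ᶠ wt : (Fin d → ℝ) × ℝ in 𝓝[L] (δ n) ×ˢ atTop, ∀ᶠ m in (q : Filter ℕ),
        SignType.sign (MvPolynomial.eval (z + κ • (wt.1 + wt.2 • ε m)) f) = σ := by
  have hmem : ∀ w : Fin d → ℝ, ∀ᶠ wt : (Fin d → ℝ) × ℝ in 𝓝[(L : Set _)] w ×ˢ atTop,
      wt.1 ∈ L := fun w => tendsto_fst.eventually (eventually_mem_nhdsWithin)
  obtain ⟨W, hW, hmemW⟩ := exists_fg_affineExpansion_mem L z κ f
  rcases exists_normalized_limit hW q (fun m => affineExpansion L z κ (ε m) f)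
    (fun m => hmemW (ε m)) with h | ⟨b, P, hb, hP0, hlim⟩
  · refine Eventually.of_forall fun n => ⟨0, ?_⟩
    filter_upwards [hmem (δ n)] with wt hwt
    filter_upwards [h] with m hm
    have := eval_affineExpansion L z κ (ε m) f ⟨wt.1, hwt⟩ wt.2
    rw [hm, Polynomial.map_zero, Polynomial.eval_zero] at this
    rw [sign_eq_zero_iff]
    exact this.symm
  · obtain ⟨h, hh⟩ := polyFunctions_eq_eval P.leadingCoeff
    -- The coefficients are functions on `L`, so a leading coefficient vanishing along `δ` would be
    -- zero by density.
    have hne : ¬ ∀ᶠ m in (q : Filter ℕ), MvPolynomial.eval (δ m) h = 0 := by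
      intro h1
      refine hP0 (Polynomial.leadingCoeff_eq_zero.1 (Subtype.ext (funext fun w => ?_)))
      rw [hh w, hdense h h1 w w.2]
      rfl
    filter_upwards [Ultrafilter.eventually_not.2 hne, hδL] with n hn hnL
    refine ⟨SignType.sign (MvPolynomial.eval (δ n) h), ?_⟩
    have h2 := eventually_sign_eval (evalPolyFunction L) continuous_evalPolyFunction P ⟨δ n, hnL⟩
      (by change P.leadingCoeff.1 ⟨δ n, hnL⟩ ≠ 0; rw [hh]; exact hn)
    have h3 : evalPolyFunction L ⟨δ n, hnL⟩ P.leadingCoeff = MvPolynomial.eval (δ n) h :=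
      hh ⟨δ n, hnL⟩
    rw [h3] at h2
    have h4 : (𝓝[L] (δ n) ×ˢ atTop : Filter ((Fin d → ℝ) × ℝ)) =
        map (Prod.map Subtype.val id) (𝓝 (⟨δ n, hnL⟩ : L) ×ˢ (atTop : Filter ℝ)) := by
      rw [← Filter.prod_map_map_eq', map_id, nhdsWithin_eq_map_subtype_coe hnL]
      rfl
    rw [h4, eventually_map]
    filter_upwards [h2] with wt hwt
    let φ : Polynomial (polyFunctions L) →ₗ[ℝ] ℝ :=
      { toFun := fun Q => (Q.map (evalPolyFunction L wt.1)).eval wt.2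
        map_add' := fun Q Q' => by simp
        map_smul' := fun c Q => by
          rw [Algebra.smul_def, Polynomial.map_mul, Polynomial.eval_mul]
          simp [Polynomial.algebraMap_apply, evalPolyFunction] }
    have h5 : φ P ≠ 0 := by
      intro h0
      have h6 : SignType.sign (φ P) = _ := hwt
      rw [h0, sign_zero] at h6
      exact hn (sign_eq_zero_iff.1 h6.symm)
    filter_upwards [eventually_sign_eq_of_tendsto hb (hlim φ) h5] with m hm
    rw [← hwt]
    refine Eq.trans ?_ hm
    congr 1
    exact (eval_affineExpansion L z κ (ε m) f wt.1 wt.2).symm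

/-! ### The integer lattice and fractional parts -/

/-- The vectors with integer coordinates. -/
def integerLattice (d : ℕ) : AddSubgroup (Fin d → ℝ) where
  carrier := {v | ∀ i, ∃ n : ℤ, v i = n}
  add_mem' := fun {a b} ha hb i => by
    obtain ⟨n, hn⟩ := ha i
    obtain ⟨m, hm⟩ := hb i
    exact ⟨n + m, by simp [hn, hm]⟩
  zero_mem' := fun i => ⟨0, by simp⟩
  neg_mem' := fun {a} ha i => by
    obtain ⟨n, hn⟩ := ha i
    exact ⟨-n, by simp [hn]⟩

theorem intCast_smul_mem_integerLattice {d : ℕ} {v : Fin d → ℝ} (hv : v ∈ integerLattice d)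
    (a : ℤ) : (a : ℝ) • v ∈ integerLattice d := by
  intro i
  obtain ⟨n, hn⟩ := hv i
  exact ⟨a * n, by simp [hn]⟩

theorem natCast_smul_mem_integerLattice {d : ℕ} {v : Fin d → ℝ} (hv : v ∈ integerLattice d)
    (a : ℕ) : (a : ℝ) • v ∈ integerLattice d := by
  exact_mod_cast intCast_smul_mem_integerLattice hv a

theorem pow_smul_mem_integerLattice {d : ℕ} {v : Fin d → ℝ} (hv : v ∈ integerLattice d)
    (k n : ℕ) : (k : ℝ) ^ n • v ∈ integerLattice d := by
  exact_mod_cast natCast_smul_mem_integerLattice hv (k ^ n)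

theorem eq_zero_of_mem_integerLattice {d : ℕ} {v : Fin d → ℝ} (hv : v ∈ integerLattice d)
    (h : ‖v‖ < 1) : v = 0 := by
  funext i
  obtain ⟨n, hn⟩ := hv i
  have h1 : ‖v i‖ < 1 := (norm_le_pi_norm v i).trans_lt h
  rw [hn, Real.norm_eq_abs, ← Int.cast_abs] at h1
  have h2 : |n| < 1 := by exact_mod_cast h1
  rw [hn, Int.abs_lt_one_iff.1 h2, Int.cast_zero, Pi.zero_apply]

theorem sub_fracPart_mem_integerLattice {d : ℕ} (v : Fin d → ℝ) :
    v - fracPart v ∈ integerLattice d := fun i => ⟨⌊v i⌋, by simp [fracPart]⟩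

theorem fracPart_eq_of_sub_mem {d : ℕ} {v w : Fin d → ℝ} (h : v - w ∈ integerLattice d) :
    fracPart v = fracPart w := by
  funext i
  obtain ⟨n, hn⟩ := h i
  rw [Pi.sub_apply] at hn
  rw [fracPart, fracPart, Int.fract_eq_fract]
  exact ⟨n, hn⟩

theorem fracPart_of_mem_halfOpenCube {d : ℕ} {v : Fin d → ℝ} (h : v ∈ halfOpenCube d) :
    fracPart v = v := funext fun i => Int.fract_eq_self.2 (h i)

theorem timesMap_fracPart {d : ℕ} (l : ℕ) (v : Fin d → ℝ) :
    timesMap l (fracPart v) = fracPart ((l : ℝ) • v) := by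
  refine fracPart_eq_of_sub_mem ?_
  rw [← smul_sub, ← neg_sub, smul_neg]
  exact neg_mem (natCast_smul_mem_integerLattice (sub_fracPart_mem_integerLattice v) l)

theorem iterate_timesMap {d : ℕ} (k : ℕ) {x : Fin d → ℝ} (hx : x ∈ halfOpenCube d) (n : ℕ) :
    (timesMap k)^[n] x = fracPart ((k : ℝ) ^ n • x) := by
  induction n with
  | zero => simp [fracPart_of_mem_halfOpenCube hx]
  | succ n ih => rw [Function.iterate_succ_apply', ih, timesMap_fracPart, smul_smul, pow_succ']

/-! ### Limits of orbits along an ultrafilter -/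

theorem exists_limit_lift {d : ℕ} (q : Ultrafilter ℕ) (X : ℕ → Fin d → ℝ) :
    ∃ (y : Fin d → ℝ) (ε : ℕ → Fin d → ℝ), Tendsto ε q (𝓝 0) ∧
      ∀ n, X n - y - ε n ∈ integerLattice d := by
  have h1 : ((q.map fun n => fracPart (X n) : Ultrafilter _) : Filter (Fin d → ℝ)) ≤
      𝓟 (Set.Icc 0 1) := by
    rw [le_principal_iff]
    change ∀ᶠ n in (q : Filter ℕ), fracPart (X n) ∈ Set.Icc (0 : Fin d → ℝ) 1
    exact Eventually.of_forall fun n => ⟨fun i => Int.fract_nonneg _,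
      fun i => (Int.fract_lt_one _).le⟩
  obtain ⟨y, -, hy⟩ := isCompact_Icc.ultrafilter_le_nhds _ h1
  have h2 : Tendsto (fun n => fracPart (X n)) q (𝓝 y) := hy
  refine ⟨y, fun n => fracPart (X n) - y, ?_, fun n => ?_⟩
  · simpa using h2.sub_const y
  · rw [sub_sub, add_sub_cancel]
    exact sub_fracPart_mem_integerLattice _

theorem eventually_norm_pow_smul_lt {d : ℕ} (k n : ℕ) {q : Ultrafilter ℕ}
    {ε : ℕ → Fin d → ℝ} (hε : Tendsto ε q (𝓝 0)) {η : ℝ} (hη : 0 < η) :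
    ∀ᶠ m in (q : Filter ℕ), ‖(k : ℝ) ^ n • ε m‖ < η := by
  have h1 : Tendsto (fun m => (k : ℝ) ^ n • ε m) q (𝓝 0) := by
    simpa using hε.const_smul ((k : ℝ) ^ n)
  exact (tendsto_zero_iff_norm_tendsto_zero.1 h1).eventually (gt_mem_nhds hη)

/-- Modulo the lattice, `k ^ n • y - y` equals `ε (n + m) - k ^ n • ε m`, which is small for a
suitable `m`; rounding to the nearest lattice point can only do better. -/
theorem exists_return_error {d k : ℕ} {q : Ultrafilter ℕ} (hq : q + q = q) {x y : Fin d → ℝ}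
    {ε : ℕ → Fin d → ℝ} (hε : Tendsto ε q (𝓝 0))
    (hx : ∀ n, (k : ℝ) ^ n • x - y - ε n ∈ integerLattice d) :
    ∃ δ : ℕ → Fin d → ℝ, Tendsto δ q (𝓝 0) ∧
      ∀ n, (k : ℝ) ^ n • y - y - δ n ∈ integerLattice d := by
  let D : ℕ → Fin d → ℝ := fun n => (k : ℝ) ^ n • y - y
  refine ⟨fun n i => D n i - round (D n i), ?_, fun n i => ⟨round (D n i), by simp [D]⟩⟩
  rw [tendsto_zero_iff_norm_tendsto_zero, Metric.tendsto_nhds]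
  intro η hη
  have h1 : ∀ᶠ n in (q : Filter ℕ), ‖ε n‖ < η / 2 :=
    (tendsto_zero_iff_norm_tendsto_zero.1 hε).eventually (gt_mem_nhds (half_pos hη))
  filter_upwards [eventually_add_of_idempotent hq h1] with n hn
  obtain ⟨m, h2, h3⟩ := (hn.and (eventually_norm_pow_smul_lt k n hε (half_pos hη))).exists
  have h4 : D n - (ε (n + m) - (k : ℝ) ^ n • ε m) ∈ integerLattice d := by
    have h5 := sub_mem (hx (n + m)) (pow_smul_mem_integerLattice (hx m) k n)
    rw [pow_add, mul_smul] at h5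
    convert h5 using 1
    simp only [D, smul_sub]
    abel
  rw [dist_zero_right, norm_norm]
  refine lt_of_le_of_lt ((pi_norm_le_iff_of_nonneg (norm_nonneg _)).2 fun i => ?_)
    (calc ‖ε (n + m) - (k : ℝ) ^ n • ε m‖ ≤ _ := norm_sub_le _ _
      _ < η / 2 + η / 2 := add_lt_add h2 h3
      _ = η := add_halves η)
  obtain ⟨a, ha⟩ := h4 i
  rw [Real.norm_eq_abs]
  refine (round_le (D n i) a).trans ?_
  rw [← ha, Pi.sub_apply, sub_sub_cancel, ← Real.norm_eq_abs]
  exact norm_le_pi_norm (ε (n + m) - (k : ℝ) ^ n • ε m) i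

/-- Both sides agree modulo the lattice and their difference has norm below `1`. The case `x = y`,
`ε = δ` gives the rule for `δ` itself. -/
theorem eventually_cocycle {d k : ℕ} {q : Ultrafilter ℕ} (hq : q + q = q) {x y : Fin d → ℝ}
    {ε δ : ℕ → Fin d → ℝ} (hε : Tendsto ε q (𝓝 0)) (hδ : Tendsto δ q (𝓝 0))
    (hx : ∀ n, (k : ℝ) ^ n • x - y - ε n ∈ integerLattice d)
    (hy : ∀ n, (k : ℝ) ^ n • y - y - δ n ∈ integerLattice d) :
    ∀ᶠ n in (q : Filter ℕ), ∀ᶠ m in (q : Filter ℕ), ε (n + m) = δ n + (k : ℝ) ^ n • ε m := by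
  have h1 : ∀ᶠ n in (q : Filter ℕ), ‖ε n‖ < 1 / 4 :=
    (tendsto_zero_iff_norm_tendsto_zero.1 hε).eventually (gt_mem_nhds (by norm_num))
  have h2 : ∀ᶠ n in (q : Filter ℕ), ‖δ n‖ < 1 / 4 :=
    (tendsto_zero_iff_norm_tendsto_zero.1 hδ).eventually (gt_mem_nhds (by norm_num))
  filter_upwards [eventually_add_of_idempotent hq h1, h2] with n h3 h4
  filter_upwards [h3, eventually_norm_pow_smul_lt k n hε (by norm_num : (0 : ℝ) < 1 / 4)]
    with m h5 h6
  rw [← sub_eq_zero]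
  refine eq_zero_of_mem_integerLattice ?_ ?_
  · have h7 := add_mem (sub_mem (pow_smul_mem_integerLattice (hx m) k n) (hx (n + m))) (hy n)
    rw [pow_add, mul_smul] at h7
    convert h7 using 1
    simp only [smul_sub]
    abel
  · calc ‖ε (n + m) - (δ n + (k : ℝ) ^ n • ε m)‖ ≤ ‖ε (n + m)‖ + ‖δ n + (k : ℝ) ^ n • ε m‖ :=
        norm_sub_le _ _
      _ ≤ ‖ε (n + m)‖ + (‖δ n‖ + ‖(k : ℝ) ^ n • ε m‖) := by gcongr; exact norm_add_le _ _
      _ < 1 := by linarith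

/-! ### Recurrence along finite sums -/

/-- Pigeonhole on partial sums: two of them nearly agree after multiplication by `θ` modulo `1` and
agree modulo `Q`, and their difference is the sum of a block of more than `B` terms. -/
theorem exists_mem_FS_near_integers {r : ℕ} (θ : Fin r → ℝ) {Q : ℕ} (hQ : 0 < Q)
    (a : Stream' ℕ) (ha : ∀ i, 0 < a.get i) {η : ℝ} (hη : 0 < η) (B : ℕ) :
    ∃ l ∈ Hindman.FS a, B ≤ l ∧ Q ∣ l ∧ ∃ u : Fin r → ℤ, ∀ i, |(l : ℝ) * θ i - u i| < η := by
  let s : ℕ → ℕ := fun j => ∑ i ∈ Finset.range j, a.get i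
  let U : Ultrafilter ℕ := hyperfilter ℕ
  have hU : (U : Filter ℕ) ≤ atTop := Nat.hyperfilter_le_atTop
  obtain ⟨c, ε, hε, hlift⟩ := exists_limit_lift U fun j => (s j : ℝ) • θ
  obtain ⟨e, -, he⟩ : ∃ e ∈ Set.Iio Q, ∀ᶠ j in (U : Filter ℕ), s j % Q = e := by
    rw [← Ultrafilter.eventually_exists_mem_iff (Set.finite_Iio Q)]
    exact Eventually.of_forall fun j => ⟨_, Nat.mod_lt _ hQ, rfl⟩
  have h1 : ∀ᶠ j in (U : Filter ℕ), ‖ε j‖ < η / 2 :=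
    (tendsto_zero_iff_norm_tendsto_zero.1 hε).eventually (gt_mem_nhds (half_pos hη))
  obtain ⟨j₁, hj₁e, hj₁⟩ := (he.and h1).exists
  obtain ⟨j₂, ⟨hj₂e, hj₂⟩, hlt⟩ := ((he.and h1).and (hU (eventually_gt_atTop (j₁ + B)))).exists
  have hs : s j₁ + ∑ i ∈ Finset.Ico j₁ j₂, a.get i = s j₂ :=
    Finset.sum_range_add_sum_Ico _ (by omega)
  refine ⟨∑ i ∈ Finset.Ico j₁ j₂, a.get i,
    Hindman.FS.finsetSum a _ (Finset.nonempty_Ico.2 (by omega)), ?_, ?_, ?_⟩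
  · have h2 : ∑ i ∈ Finset.Ico j₁ j₂, 1 ≤ ∑ i ∈ Finset.Ico j₁ j₂, a.get i :=
      Finset.sum_le_sum fun i _ => ha i
    simp only [Finset.sum_const, Nat.card_Ico, smul_eq_mul, mul_one] at h2
    omega
  · rw [← Nat.modEq_zero_iff_dvd]
    refine Nat.ModEq.add_left_cancel' (s j₁) ?_
    rw [hs, add_zero]
    exact hj₂e.trans hj₁e.symm
  · have h3 := sub_mem (hlift j₂) (hlift j₁)
    choose u hu using h3
    refine ⟨u, fun i => ?_⟩
    have h4 : ((∑ i ∈ Finset.Ico j₁ j₂, a.get i : ℕ) : ℝ) = s j₂ - s j₁ := by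
      rw [← hs, Nat.cast_add, add_sub_cancel_left]
    have h5 := hu i
    simp only [Pi.sub_apply, Pi.smul_apply, smul_eq_mul] at h5
    rw [h4, ← h5]
    have h6 : (s j₂ - s j₁ : ℝ) * θ i - (s j₂ * θ i - c i - ε j₂ i - (s j₁ * θ i - c i - ε j₁ i)) =
        (ε j₂ - ε j₁) i := by rw [Pi.sub_apply]; ring
    rw [h6, ← Real.norm_eq_abs]
    calc ‖(ε j₂ - ε j₁) i‖ ≤ ‖ε j₂ - ε j₁‖ := norm_le_pi_norm _ i
      _ ≤ ‖ε j₂‖ + ‖ε j₁‖ := norm_sub_le _ _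
      _ < η := by linarith

/-- A point that differs from a rational point by an element of a rational subspace `span G` is
brought close to the integer lattice, within `span G`, by finite sums of every sequence. -/
theorem exists_mem_FS_smul_near {d : ℕ} {G : Set (Fin d → ℝ)}
    (hG : ∀ g ∈ G, ∃ N : ℕ, 0 < N ∧ (N : ℝ) • g ∈ integerLattice d) {y v : Fin d → ℝ}
    (hv : v ∈ Submodule.span ℝ G)
    (hy : ∃ N : ℕ, 0 < N ∧ (N : ℝ) • (y + v) ∈ integerLattice d)
    (a : Stream' ℕ) (ha : ∀ i, 0 < a.get i) {η : ℝ} (hη : 0 < η) (B : ℕ) :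
    ∃ l ∈ Hindman.FS a, B ≤ l ∧ ∃ w ∈ Submodule.span ℝ G, ‖w‖ < η ∧
      (l : ℝ) • y - w ∈ integerLattice d := by
  obtain ⟨r, c, g, rfl⟩ := Submodule.mem_span_set'.1 hv
  choose N hN hNg using fun i => hG (g i) (g i).2
  obtain ⟨Q, hQ, hQy⟩ := hy
  have hpos : 0 < ∑ i, ‖(N i : ℝ) • (g i : Fin d → ℝ)‖ + 1 := by positivity
  obtain ⟨l, hl, hBl, ⟨l', rfl⟩, u, hu⟩ := exists_mem_FS_near_integers
    (fun i => c i / N i) hQ a ha (div_pos hη hpos) B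
  set θ : Fin r → ℝ := fun i => c i / N i with hθ
  have hc : ∀ i, c i • (g i : Fin d → ℝ) = θ i • ((N i : ℝ) • (g i : Fin d → ℝ)) := by
    intro i
    have := (Nat.cast_pos (α := ℝ)).2 (hN i)
    rw [hθ, smul_smul, div_mul_cancel₀ _ this.ne']
  -- Write `l • y = l • (y + v) - l • v`. The first term is integral because `Q ∣ l`; in the second,
  -- `l * θ i` is replaced by its distance to the integer `u i`.
  refine ⟨_, hl, hBl,
    -∑ i, (((Q * l' : ℕ) : ℝ) * θ i - u i) • ((N i : ℝ) • (g i : Fin d → ℝ)), ?_, ?_, ?_⟩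
  · exact neg_mem (Submodule.sum_mem _ fun i _ => Submodule.smul_mem _ _
      (Submodule.smul_mem _ _ (Submodule.subset_span (g i).2)))
  · rw [norm_neg]
    calc _ ≤ ∑ i, ‖(((Q * l' : ℕ) : ℝ) * θ i - u i) • ((N i : ℝ) • (g i : Fin d → ℝ))‖ :=
          norm_sum_le _ _
      _ ≤ ∑ i, η / (∑ i, ‖(N i : ℝ) • (g i : Fin d → ℝ)‖ + 1) *
            ‖(N i : ℝ) • (g i : Fin d → ℝ)‖ := by
          refine Finset.sum_le_sum fun i _ => ?_
          rw [norm_smul]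
          exact mul_le_mul_of_nonneg_right (hu i).le (norm_nonneg _)
      _ < η := by
          rw [← Finset.mul_sum, div_mul_eq_mul_div, div_lt_iff₀ hpos]
          nlinarith
  · have h1 := natCast_smul_mem_integerLattice hQy l'
    have h2 : ∑ i, (u i : ℝ) • ((N i : ℝ) • (g i : Fin d → ℝ)) ∈ integerLattice d :=
      sum_mem fun i _ => intCast_smul_mem_integerLattice (hNg i) (u i)
    convert sub_mem h1 h2 using 1
    simp only [hc, sub_smul, Finset.sum_sub_distrib, mul_smul, ← Finset.smul_sum]
    push_cast
    module

/-! ### Idempotents from central sets -/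

theorem tendsto_iterate_add {X : Type*} [TopologicalSpace X] [T3Space X] {T : X → X}
    (hT : Continuous T) {r p : Ultrafilter ℕ} {x y z : X} (hp : Tendsto (fun n => T^[n] x) p (𝓝 y))
    (hr : Tendsto (fun n => T^[n] y) r (𝓝 z)) :
    Tendsto (fun n => T^[n] x) (r + p : Ultrafilter ℕ) (𝓝 z) := by
  intro V hV
  obtain ⟨W, hW, hWc, hWV⟩ := exists_mem_nhds_isClosed_subset hV
  change ∀ᶠ n in ((r + p : Ultrafilter ℕ) : Filter ℕ), T^[n] x ∈ V
  rw [Ultrafilter.eventually_add]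
  have h1 : ∀ᶠ n in (r : Filter ℕ), T^[n] y ∈ interior W :=
    hr (interior_mem_nhds.2 hW)
  filter_upwards [h1] with n hn
  have h2 : Tendsto (fun m => T^[n] (T^[m] x)) p (𝓝 (T^[n] y)) :=
    ((hT.iterate n).tendsto y).comp hp
  filter_upwards [h2 (isOpen_interior.mem_nhds hn)] with m hm
  rw [Function.iterate_add_apply]
  exact hWV (interior_subset hm)

/-- From each `T^[n] y` a return to `W` takes at most `L` steps; the ultrafilter selects a single
number of steps `j`, and the limit gives `T^[j] z ∈ W`. -/
theorem exists_tendsto_iterate_of_uniformlyRecurrent {X : Type*} [TopologicalSpace X]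
    [CompactSpace X] [T2Space X] {T : X → X} (hT : Continuous T) {y z : X}
    (hy : IsUniformlyRecurrent T y) {p : Ultrafilter ℕ} (hz : Tendsto (fun n => T^[n] y) p (𝓝 z)) :
    ∃ r : Ultrafilter ℕ, Tendsto (fun n => T^[n] z) r (𝓝 y) := by
  have h1 : ∀ V ∈ 𝓝 y, ∃ n, T^[n] z ∈ V := by
    intro V hV
    obtain ⟨W, hW, hWc, hWV⟩ := exists_mem_nhds_isClosed_subset hV
    obtain ⟨L, hL⟩ := hy (interior W) isOpen_interior (mem_interior_iff_mem_nhds.2 hW)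
    have h2 : ∀ᶠ n in (p : Filter ℕ), ∃ j ∈ Set.Iic L, T^[j] (T^[n] y) ∈ W := by
      refine Eventually.of_forall fun n => ?_
      obtain ⟨m, hm, hnm, hmL⟩ := hL n
      refine ⟨m - n, Set.mem_Iic.2 (by omega), ?_⟩
      rw [← Function.iterate_add_apply, Nat.sub_add_cancel hnm]
      exact interior_subset hm.2
    obtain ⟨j, -, hj⟩ := (Ultrafilter.eventually_exists_mem_iff (Set.finite_Iic L)).1 h2
    have h3 : Tendsto (fun n => T^[j] (T^[n] y)) p (𝓝 (T^[j] z)) :=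
      ((hT.iterate j).tendsto z).comp hz
    exact ⟨j, hWV (hWc.mem_of_tendsto h3 hj)⟩
  have h4 : (comap (fun n => T^[n] z) (𝓝 y)).NeBot := comap_neBot h1
  exact ⟨Ultrafilter.of _, tendsto_iff_comap.2 (Ultrafilter.of_le _)⟩

theorem add_le_atTop {r p : Ultrafilter ℕ} (hp : (p : Filter ℕ) ≤ atTop) :
    ((r + p : Ultrafilter ℕ) : Filter ℕ) ≤ atTop := by
  refine atTop_basis.ge_iff.2 fun B _ => ?_
  change ∀ᶠ n in ((r + p : Ultrafilter ℕ) : Filter ℕ), B ≤ n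
  rw [Ultrafilter.eventually_add]
  refine Eventually.of_forall fun n => ?_
  filter_upwards [hp (eventually_ge_atTop B)] with m hm
  exact hm.trans (Nat.le_add_left m n)

/-- The free ultrafilters along which both orbits tend to `y` form a closed subsemigroup, and Ellis'
lemma gives an idempotent in it. Proximality brings both orbits to a common limit, which uniform
recurrence of `y` carries back to `y`. -/
theorem IsCentral.exists_idempotent {E : Set ℕ} (hE : IsCentral E) :
    ∃ q : Ultrafilter ℕ, q + q = q ∧ (q : Filter ℕ) ≤ atTop ∧ E ∈ q := by
  obtain ⟨X, _, _, T, x, y, U, hT, hprox, hrec, hU, hyU, rfl⟩ := hE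
  let J : Set (Ultrafilter ℕ) := {p | (p : Filter ℕ) ≤ atTop ∧ Tendsto (fun n => T^[n] x) p (𝓝 y) ∧
    Tendsto (fun n => T^[n] y) p (𝓝 y)}
  have hlim : ∀ (p : Ultrafilter ℕ) (w : X), ∃ z, Tendsto (fun n => T^[n] w) p (𝓝 z) := fun p w => by
    obtain ⟨z, -, hz⟩ := isCompact_univ.ultrafilter_le_nhds (p.map fun n => T^[n] w) (by simp)
    exact ⟨z, hz⟩
  have hne : J.Nonempty := by
    have h1 : (⨅ ε : Set.Ioi (0 : ℝ), atTop ⊓ 𝓟 {n : ℕ | dist (T^[n] x) (T^[n] y) < ε}).NeBot := by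
      have : Nonempty (Set.Ioi (0 : ℝ)) := ⟨⟨1, Set.mem_Ioi.2 one_pos⟩⟩
      refine iInf_neBot_of_directed' ?_ fun ε => frequently_mem_iff_neBot.1 (hprox ε ε.2)
      intro ε ε'
      refine ⟨⟨min ε ε', Set.mem_Ioi.2 (lt_min ε.2 ε'.2)⟩, ?_, ?_⟩
      · exact inf_le_inf_left _ (principal_mono.2 fun n hn => by
          rw [Set.mem_ofPred_eq] at hn ⊢
          exact (lt_min_iff.1 hn).1)
      · exact inf_le_inf_left _ (principal_mono.2 fun n hn => by
          rw [Set.mem_ofPred_eq] at hn ⊢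
          exact (lt_min_iff.1 hn).2)
    obtain ⟨p, hp⟩ := Ultrafilter.exists_le
      (⨅ ε : Set.Ioi (0 : ℝ), atTop ⊓ 𝓟 {n : ℕ | dist (T^[n] x) (T^[n] y) < ε})
    have hpε : ∀ ε : Set.Ioi (0 : ℝ), (p : Filter ℕ) ≤
        atTop ⊓ 𝓟 {n : ℕ | dist (T^[n] x) (T^[n] y) < ε} := fun ε => hp.trans (iInf_le _ ε)
    have hptop : (p : Filter ℕ) ≤ atTop := (hpε ⟨1, Set.mem_Ioi.2 one_pos⟩).trans inf_le_left
    obtain ⟨z, hz⟩ := hlim p y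
    have hxz : Tendsto (fun n => T^[n] x) p (𝓝 z) := by
      refine (tendsto_iff_of_dist ?_).2 hz
      rw [Metric.tendsto_nhds]
      intro ε hε
      have h2 : ∀ᶠ n in (p : Filter ℕ), dist (T^[n] x) (T^[n] y) < ε :=
        le_principal_iff.1 ((hpε ⟨ε, hε⟩).trans inf_le_right)
      filter_upwards [h2] with n hn
      rwa [Real.dist_0_eq_abs, abs_of_nonneg dist_nonneg]
    obtain ⟨r, hr⟩ := exists_tendsto_iterate_of_uniformlyRecurrent hT hrec hz
    exact ⟨r + p, add_le_atTop hptop, tendsto_iterate_add hT hxz hr, tendsto_iterate_add hT hz hr⟩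
  have hclosed : IsClosed J := by
    have h1 : ∀ w : X, IsClosed {p : Ultrafilter ℕ | Tendsto (fun n => T^[n] w) p (𝓝 y)} := by
      intro w
      have h2 : {p : Ultrafilter ℕ | Tendsto (fun n => T^[n] w) p (𝓝 y)} =
          Ultrafilter.extend (fun n => T^[n] w) ⁻¹' {y} := by
        ext p
        exact (ultrafilter_extend_eq_iff (f := fun n => T^[n] w)).symm
      rw [h2]
      exact isClosed_singleton.preimage (continuous_ultrafilter_extend _)
    have h3 : IsClosed {p : Ultrafilter ℕ | (p : Filter ℕ) ≤ atTop} := by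
      have h4 : {p : Ultrafilter ℕ | (p : Filter ℕ) ≤ atTop} =
          ⋂ B : ℕ, {p : Ultrafilter ℕ | Set.Ici B ∈ p} := by
        ext p
        simp [atTop_basis.ge_iff]
      rw [h4]
      exact isClosed_iInter fun B => ultrafilter_isClosed_basic _
    exact h3.inter ((h1 x).inter (h1 y))
  let _ := Ultrafilter.addSemigroup (M := ℕ)
  obtain ⟨q, hq, hqq⟩ := exists_idempotent_in_compact_add_subsemigroup
    Ultrafilter.continuous_add_left J hne hclosed.isCompact
    (fun r hr p hp => ⟨add_le_atTop hp.1, tendsto_iterate_add hT hp.2.1 hr.2.2,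
      tendsto_iterate_add hT hp.2.2 hr.2.2⟩)
  refine ⟨q, hqq, hq.1, ?_⟩
  have h1 : ∀ᶠ n in (q : Filter ℕ), 0 < n := hq.1 (eventually_gt_atTop 0)
  exact h1.and (hq.2.1 (hU.mem_nhds hyU))

/-- The only principal idempotent is the one at `0`, and it is not minimal because `s + 1 = 0` has
no solution. -/
theorem IsMinimalIdempotent.le_atTop {q : Ultrafilter ℕ} (hq : IsMinimalIdempotent q) :
    (q : Filter ℕ) ≤ atTop := by
  rw [← Nat.cofinite_eq_atTop]
  refine q.le_cofinite_or_eq_pure.resolve_right ?_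
  rintro ⟨a, rfl⟩
  have h1 : ∀ᶠ n in ((pure a + pure a : Ultrafilter ℕ) : Filter ℕ), n = a := by
    rw [hq.1]
    exact rfl
  rw [Ultrafilter.eventually_add] at h1
  have h2 : a + a = a := h1
  obtain ⟨s, hs⟩ := hq.2 (pure 1)
  have h3 : ∀ᶠ n in ((s + (pure 1 + pure a) : Ultrafilter ℕ) : Filter ℕ), n = a := by
    rw [hs]
    exact rfl
  rw [Ultrafilter.eventually_add] at h3
  obtain ⟨n, hn⟩ := h3.exists
  have h4 : n + (1 + a) = a := hn
  omega

/-! ### The main theorem -/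

theorem IsSemialgebraic.exists_basic {d : ℕ} {S : Set (Fin d → ℝ)} (hS : IsSemialgebraic S)
    {q : Ultrafilter ℕ} {X : ℕ → Fin d → ℝ} (h : ∀ᶠ m in (q : Filter ℕ), X m ∈ S) :
    ∃ F G : Finset (MvPolynomial (Fin d) ℝ),
      {x | (∀ f ∈ F, MvPolynomial.eval x f = 0) ∧ (∀ g ∈ G, 0 < MvPolynomial.eval x g)} ⊆ S ∧
      ∀ᶠ m in (q : Filter ℕ), (∀ f ∈ F, MvPolynomial.eval (X m) f = 0) ∧
        (∀ g ∈ G, 0 < MvPolynomial.eval (X m) g) := by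
  obtain ⟨C, hC, hB, rfl⟩ := hS
  obtain ⟨B, hBC, hBq⟩ := (Ultrafilter.eventually_exists_mem_iff hC).1 h
  obtain ⟨F, G, rfl⟩ := hB B hBC
  exact ⟨F, G, Set.subset_sUnion_of_mem hBC, hBq⟩

/-- Points converging along an ultrafilter with fractional parts in `S` lie almost surely in a
single integer translate of `S`. -/
theorem exists_translate_mem {d : ℕ} {S : Set (Fin d → ℝ)} {q : Ultrafilter ℕ}
    {ε : ℕ → Fin d → ℝ} (hε : Tendsto ε q (𝓝 0)) (Z : Fin d → ℝ)
    (h : ∀ᶠ m in (q : Filter ℕ), fracPart (Z + ε m) ∈ S) :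
    ∃ z, Z - z ∈ integerLattice d ∧ ∀ᶠ m in (q : Filter ℕ), z + ε m ∈ S := by
  -- Once `‖ε m‖ < 1` each floor takes finitely many values, so it is almost surely constant.
  have h1 : ∀ i, ∃ u : ℤ, ∀ᶠ m in (q : Filter ℕ), ⌊Z i + ε m i⌋ = u := by
    intro i
    obtain ⟨u, -, hu⟩ : ∃ u ∈ Set.Icc (⌊Z i - 1⌋) (⌊Z i + 1⌋),
        ∀ᶠ m in (q : Filter ℕ), ⌊Z i + ε m i⌋ = u := by
      rw [← Ultrafilter.eventually_exists_mem_iff (Set.finite_Icc _ _)]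
      filter_upwards [(tendsto_zero_iff_norm_tendsto_zero.1 hε).eventually
        (gt_mem_nhds one_pos)] with m hm
      have h2 := abs_lt.1 ((norm_le_pi_norm (ε m) i).trans_lt hm)
      exact ⟨_, ⟨Int.floor_mono (by linarith), Int.floor_mono (by linarith)⟩, rfl⟩
    exact ⟨u, hu⟩
  choose u hu using h1
  refine ⟨fun i => Z i - u i, fun i => ⟨u i, by simp⟩, ?_⟩
  filter_upwards [h, eventually_all.2 hu] with m hm hm'
  convert hm using 1
  funext i
  simp only [Pi.add_apply, fracPart, Int.fract, hm' i]
  ring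

/-- The common core of the two parts of the main theorem. -/
theorem exists_shift_forall_stream {d k : ℕ} (hk : 2 ≤ k) {S : Set (Fin d → ℝ)}
    (hS : IsSemialgebraic S) (hS' : S ⊆ halfOpenCube d) {q : Ultrafilter ℕ} (hq : q + q = q)
    (hq' : (q : Filter ℕ) ≤ atTop) (r : Ultrafilter ℕ) (x : Fin d → ℝ)
    (hx : ∀ᶠ n in ((r + q : Ultrafilter ℕ) : Filter ℕ), fracPart ((k : ℝ) ^ n • x) ∈ S) :
    ∃ C : ℕ, ∀ a : Stream' ℕ, (∀ i, 0 < a.get i) → ∃ l : ℕ, 0 < l ∧ l + C ∈ Hindman.FS a ∧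
      ∀ᶠ n in (q : Filter ℕ), fracPart (((l : ℝ) * (k : ℝ) ^ n) • x) ∈ S := by
  obtain ⟨y, ε, hε, hxy⟩ := exists_limit_lift q fun n => (k : ℝ) ^ n • x
  obtain ⟨δ, hδ, hyy⟩ := exists_return_error hq hε hxy
  have hcε := eventually_cocycle hq hε hδ hxy hyy
  have hcδ := eventually_cocycle hq hδ hδ hyy hyy
  obtain ⟨A, hA, hApos, L, hL, hAL, hdense⟩ :=
    exists_zariski_dense_subspace hk hq hq' hδ hcδ
  have hδL : ∀ᶠ n in (q : Filter ℕ), δ n ∈ L := by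
    filter_upwards [hA] with n hn using (hAL n hn).1
  obtain ⟨n₀, hn₀⟩ := q.nonempty_of_mem hA
  have hkpos : (0 : ℝ) < k := by exact_mod_cast (by omega : 0 < k)
  have hfix : ∀ n ∈ A, ((k : ℝ) ^ n - 1) • (y + fixedPt k δ n) ∈ integerLattice d := by
    intro n hn
    rw [smul_add, smul_fixedPt hk (hApos n hn), sub_smul, one_smul, ← sub_eq_add_neg]
    exact hyy n
  have hcast : ∀ n, (((k ^ n - 1 : ℕ) : ℕ) : ℝ) = (k : ℝ) ^ n - 1 := fun n => by
    rw [Nat.cast_sub (Nat.one_le_pow _ _ (by omega))]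
    push_cast
    rfl
  have hNpos : ∀ n ∈ A, 0 < k ^ n - 1 := fun n hn =>
    Nat.sub_pos_of_lt (Nat.one_lt_pow (hApos n hn).ne' (by omega))
  have hrec : ∀ a : Stream' ℕ, (∀ i, 0 < a.get i) → ∀ η : ℝ, 0 < η → ∀ B : ℕ,
      ∃ l ∈ Hindman.FS a, B ≤ l ∧ ∃ w ∈ L, ‖w‖ < η ∧ (l : ℝ) • y - w ∈ integerLattice d := by
    intro a ha η hη B
    have hv := (hAL n₀ hn₀).2
    rw [hL] at hv ⊢
    refine exists_mem_FS_smul_near ?_ hv ⟨k ^ n₀ - 1, hNpos n₀ hn₀, ?_⟩ a ha hη B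
    · rintro _ ⟨n, hn, n', hn', rfl⟩
      refine ⟨(k ^ n - 1) * (k ^ n' - 1), Nat.mul_pos (hNpos n hn) (hNpos n' hn'), ?_⟩
      have h1 := natCast_smul_mem_integerLattice (hfix n hn) (k ^ n' - 1)
      have h2 := natCast_smul_mem_integerLattice (hfix n' hn') (k ^ n - 1)
      convert sub_mem h1 h2 using 1
      rw [Nat.cast_mul, hcast, hcast]
      module
    · rw [hcast]
      exact hfix n₀ hn₀
  -- a point of the orbit of `y`, close to which the hypothesis on `S` is used
  rw [Ultrafilter.eventually_add] at hx
  obtain ⟨N, hN⟩ := hx.exists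
  set κ : ℝ := (k : ℝ) ^ N with hκ
  have hκpos : 0 < κ := pow_pos hkpos N
  obtain ⟨z, hz, hzS⟩ := exists_translate_mem (S := S) (ε := fun m => κ • ε m)
    (by simpa using hε.const_smul κ) (κ • y) (by
      filter_upwards [hN] with m hm
      rw [← fracPart_eq_of_sub_mem (v := (k : ℝ) ^ (N + m) • x)]
      · exact hm
      · convert pow_smul_mem_integerLattice (hxy m) k N using 1
        rw [pow_add, mul_smul, ← hκ]
        module)
  obtain ⟨F, G, hFG, hB⟩ := hS.exists_basic hzS
  have hB2 : ∀ᶠ n in (q : Filter ℕ), ∀ᶠ n' in (q : Filter ℕ), ∀ᶠ m in (q : Filter ℕ),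
      (∀ f ∈ F, MvPolynomial.eval
        (z + κ • ((δ n + (k : ℝ) ^ n • δ n') + (k : ℝ) ^ (n + n') • ε m)) f = 0) ∧
      (∀ g ∈ G, 0 < MvPolynomial.eval
        (z + κ • ((δ n + (k : ℝ) ^ n • δ n') + (k : ℝ) ^ (n + n') • ε m)) g) := by
    have h1 := (eventually_add_of_idempotent hq hB).and hcε
    filter_upwards [eventually_add_of_idempotent hq h1, hcδ] with n h2 h3
    filter_upwards [h2, h3] with n' h4 h5
    filter_upwards [h4.1, h4.2] with m h6 h7
    rwa [h7, h5] at h6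
  have hlimwt : ∀ n, δ n ∈ L → Tendsto
      (fun n' => ((δ n + (k : ℝ) ^ n • δ n', (k : ℝ) ^ (n + n')) : (Fin d → ℝ) × ℝ)) q
      (𝓝[L] (δ n) ×ˢ atTop) := by
    intro n hn
    refine Tendsto.prodMk ?_ ?_
    · refine tendsto_nhdsWithin_iff.2 ⟨?_, ?_⟩
      · simpa using (hδ.const_smul ((k : ℝ) ^ n)).const_add (δ n)
      · filter_upwards [hδL] with n' hn'
        exact L.add_mem hn (L.smul_mem _ hn')
    · have h1 : Tendsto (fun j : ℕ => (k : ℝ) ^ j) atTop atTop :=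
        tendsto_pow_atTop_atTop_of_one_lt (by exact_mod_cast (by omega : 1 < k))
      exact (h1.comp (tendsto_add_atTop_nat n)).mono_left hq' |>.congr fun n' => by
        simp [add_comm]
  have hsign : ∀ᶠ n in (q : Filter ℕ), ∀ᶠ wt : (Fin d → ℝ) × ℝ in 𝓝[L] (δ n) ×ˢ atTop,
      ∀ᶠ m in (q : Filter ℕ), z + κ • (wt.1 + wt.2 • ε m) ∈ S := by
    have hs := fun f => eventually_exists_sign hδL hdense ε z κ f
    have hF := (Filter.eventually_all_finset F).2 fun f _ => hs f
    have hG := (Filter.eventually_all_finset G).2 fun g _ => hs g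
    filter_upwards [hF, hG, hB2, hδL] with n hFn hGn hBn hnL
    have hF' : ∀ f ∈ F, ∀ᶠ wt : (Fin d → ℝ) × ℝ in 𝓝[L] (δ n) ×ˢ atTop,
        ∀ᶠ m in (q : Filter ℕ), MvPolynomial.eval (z + κ • (wt.1 + wt.2 • ε m)) f = 0 := by
      intro f hf
      obtain ⟨σ, hσ⟩ := hFn f hf
      -- The constant sign is read off at one point `(δ n + k ^ n • δ n', k ^ (n + n'))` where the
      -- hypothesis on `S` applies.
      obtain ⟨n', h1, h2⟩ := (((hlimwt n hnL).eventually hσ).and hBn).exists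
      obtain ⟨m, h3, h4⟩ := (h1.and h2).exists
      rw [h4.1 f hf, sign_zero] at h3
      filter_upwards [hσ] with wt hwt
      filter_upwards [hwt] with m hm
      exact sign_eq_zero_iff.1 (hm.trans h3.symm)
    have hG' : ∀ g ∈ G, ∀ᶠ wt : (Fin d → ℝ) × ℝ in 𝓝[L] (δ n) ×ˢ atTop,
        ∀ᶠ m in (q : Filter ℕ), 0 < MvPolynomial.eval (z + κ • (wt.1 + wt.2 • ε m)) g := by
      intro g hg
      obtain ⟨σ, hσ⟩ := hGn g hg
      obtain ⟨n', h1, h2⟩ := (((hlimwt n hnL).eventually hσ).and hBn).exists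
      obtain ⟨m, h3, h4⟩ := (h1.and h2).exists
      rw [sign_pos (h4.2 g hg)] at h3
      filter_upwards [hσ] with wt hwt
      filter_upwards [hwt] with m hm
      exact sign_eq_one_iff.1 (hm.trans h3.symm)
    filter_upwards [(Filter.eventually_all_finset F).2 hF', (Filter.eventually_all_finset G).2 hG']
      with wt h1 h2
    filter_upwards [(Filter.eventually_all_finset F).2 h1, (Filter.eventually_all_finset G).2 h2]
      with m h3 h4
    exact hFG ⟨h3, h4⟩
  obtain ⟨n₁, hn₁, hn₁L⟩ := (hsign.and hδL).exists
  obtain ⟨⟨V, B₀⟩, ⟨hV, -⟩, hVB⟩ :=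
    (Metric.nhdsWithin_basis_ball.prod atTop_basis).eventually_iff.1 hn₁
  -- The finite sums of the constant sequence `1` are all positive integers. Taking `l₂ ≥ k ^ (N +
  -- n₁)` makes the shift a natural number.
  obtain ⟨l₂, -, hl₂, w₂, hw₂L, hw₂, hl₂w₂⟩ := hrec (Stream'.const 1) (fun i => by simp)
    (κ * (V / 2)) (by positivity) (k ^ (N + n₁))
  refine ⟨l₂ - k ^ (N + n₁), fun a ha => ?_⟩
  -- The lower bound on `l₁` ensures both `0 < l` and `B₀ ≤ l / κ`.
  obtain ⟨l₁, hl₁a, hl₁, w₁, hw₁L, hw₁, hl₁w₁⟩ := hrec a ha (κ * (V / 2)) (by positivity)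
    (l₂ + 1 + ⌈κ * B₀⌉₊)
  refine ⟨l₁ - (l₂ - k ^ (N + n₁)), by omega, by rwa [Nat.sub_add_cancel (by omega)], ?_⟩
  set l := l₁ - (l₂ - k ^ (N + n₁)) with hl
  have hlcast : (l : ℝ) = l₁ - l₂ + κ * (k : ℝ) ^ n₁ := by
    have h1 : l + l₂ = l₁ + k ^ (N + n₁) := by omega
    have h2 : (l : ℝ) + l₂ = l₁ + (k : ℝ) ^ (N + n₁) := by exact_mod_cast h1
    rw [hκ, ← pow_add]
    linarith
  have hlB : B₀ ≤ (l : ℝ) / κ := by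
    rw [le_div_iff₀ hκpos, mul_comm]
    have h1 : ⌈κ * B₀⌉₊ ≤ l := by omega
    exact (Nat.le_ceil _).trans (by exact_mod_cast h1)
  set w : Fin d → ℝ := δ n₁ + κ⁻¹ • (w₁ - w₂) with hw
  have hwV : w ∈ Metric.ball (δ n₁) V ∩ L := by
    refine ⟨?_, L.add_mem hn₁L (L.smul_mem _ (L.sub_mem hw₁L hw₂L))⟩
    rw [mem_ball_iff_norm, hw, add_sub_cancel_left, norm_smul, norm_inv, Real.norm_eq_abs,
      abs_of_pos hκpos, inv_mul_lt_iff₀ hκpos]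
    calc ‖w₁ - w₂‖ ≤ ‖w₁‖ + ‖w₂‖ := norm_sub_le _ _
      _ < κ * (V / 2) + κ * (V / 2) := add_lt_add hw₁ hw₂
      _ = κ * V := by ring
  have hfinal := hVB (x := (w, (l : ℝ) / κ)) ⟨hwV, hlB⟩
  filter_upwards [hfinal] with m hm
  have hκw : κ • (w + ((l : ℝ) / κ) • ε m) = κ • δ n₁ + (w₁ - w₂) + (l : ℝ) • ε m := by
    rw [hw, smul_add, smul_add, smul_smul, smul_smul, mul_inv_cancel₀ hκpos.ne',
      mul_div_cancel₀ _ hκpos.ne', one_smul]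
  rw [fracPart_eq_of_sub_mem (w := z + κ • (w + ((l : ℝ) / κ) • ε m)),
    fracPart_of_mem_halfOpenCube (hS' hm)]
  · exact hm
  · rw [hκw]
    have h1 := natCast_smul_mem_integerLattice (hxy m) l
    have h2 := pow_smul_mem_integerLattice (hyy n₁) k N
    have h3 := add_mem (add_mem (add_mem h1 h2) (sub_mem hl₁w₁ hl₂w₂)) hz
    convert h3 using 1
    rw [← hκ, mul_smul]
    have h4 : (l : ℝ) • y = (l₁ : ℝ) • y - (l₂ : ℝ) • y + κ • ((k : ℝ) ^ n₁ • y) := by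
      rw [hlcast]
      module
    rw [smul_sub, smul_sub, h4]
    module

theorem IsIPStarPlus.of_shift {E : Set ℕ} {C : ℕ} (hpos : ∀ l ∈ E, 0 < l)
    (h : ∀ a : Stream' ℕ, (∀ i, 0 < a.get i) → ∃ l ∈ E, l + C ∈ Hindman.FS a) :
    IsIPStarPlus E := by
  refine ⟨-C, (fun l => l + C) '' E, ?_, fun a ha => ?_, ?_⟩
  · rintro _ ⟨l, hl, rfl⟩
    exact Nat.add_pos_left (hpos l hl) C
  · obtain ⟨l, hl, hla⟩ := h a ha
    exact ⟨_, ⟨l, hl, rfl⟩, hla⟩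
  · rw [Set.image_image]
    simp

theorem mainTheorem5 (d k : ℕ) (hk : 2 ≤ k) (S : Set (Fin d → ℝ))
    (hS : IsSemialgebraic S) (hS' : S ⊆ halfOpenCube d) :
    (∀ x : Fin d → ℝ,
      IsCentral {n : ℕ | 0 < n ∧ fracPart ((k : ℝ) ^ n • x) ∈ S} →
      IsIPStarPlus {l : ℕ | 0 < l ∧
        {n : ℕ | 0 < n ∧ fracPart (((l : ℝ) * (k : ℝ) ^ n) • x) ∈ S}.Infinite}) ∧
    (∀ x₀ ∈ halfOpenCube d, ∀ p q : Ultrafilter ℕ,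
      IsMinimalIdempotent q → (∃ r : Ultrafilter ℕ, p = r + q) →
      (∀ᶠ n in (p : Filter ℕ), (timesMap k)^[n] x₀ ∈ S) →
      IsIPStarPlus {l : ℕ | 0 < l ∧
        ∀ᶠ n in (q : Filter ℕ), timesMap l ((timesMap k)^[n] x₀) ∈ S}) := by
  constructor
  · intro x hx
    obtain ⟨q, hq, hq', hmem⟩ := hx.exists_idempotent
    -- Here `r = q`, since `q = q + q`.
    obtain ⟨C, hC⟩ := exists_shift_forall_stream hk hS hS' hq hq' q x (by
      rw [hq]
      filter_upwards [hmem] with n hn using hn.2)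
    refine IsIPStarPlus.of_shift (C := C) (fun l hl => hl.1) fun a ha => ?_
    obtain ⟨l, hl, hla, hlq⟩ := hC a ha
    refine ⟨l, ⟨hl, ?_⟩, hla⟩
    have h1 : ∀ᶠ n in (q : Filter ℕ), 0 < n := hq' (eventually_gt_atTop 0)
    exact Nat.frequently_atTop_iff_infinite.1 ((h1.and hlq).frequently.filter_mono hq')
  · rintro x₀ hx₀ p q hq ⟨r, rfl⟩ hp
    simp only [iterate_timesMap k hx₀] at hp
    obtain ⟨C, hC⟩ := exists_shift_forall_stream hk hS hS' hq.1 hq.le_atTop r x₀ hp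
    refine IsIPStarPlus.of_shift (C := C) (fun l hl => hl.1) fun a ha => ?_
    obtain ⟨l, hl, hla, hlq⟩ := hC a ha
    refine ⟨l, ⟨hl, ?_⟩, hla⟩
    filter_upwards [hlq] with n hn
    rwa [iterate_timesMap k hx₀, timesMap_fracPart, smul_smul]
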